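/- There is an absolute constant $c$ such that the following holds. Let $V$ be a finite set and let $\mathcal{C} \subseteq 2^V$ be a convexity space on $V$, i.e. $\emptyset, V \in \mathcal{C}$ and $A \cap B \in \mathcal{C}$ for all $A, B \in \mathcal{C}$; for $A \subseteq V$ let $\langle A \rangle$ be the smallest member of $\mathcal{C}$ that contains $A$. Let $\omega$ be the Helly number of $\mathcal{C}$, i.e. the least integer $k \ge 0$ such that every finite family $\mathcal{A} \subseteq \mathcal{C}$, each of whose subfamilies with at most $k$ members has a nonempty intersection, has a nonempty intersection (the intersection of the empty family being $V$). Let $n, f \ge 0$ be integers with $n > \max\{3f, \omega f\}$. Then there is a deterministic protocol for $n$ processors in the synchronous message-passing model on a fully connected network, in which processor $i$ has an input $x_i \in V$ and, after the last round, irrevocably outputs a value $y_i \in V$, such that for every set $F$ of at most $f$ faulty processors, every (arbitrary, Byzantine) behaviour of the processors in $F$, and all inputs: 1. (convex consensus) with $X = \{x_i : i \notin F\}$ and $Y = \{y_i : i \notin F\}$ one has $|Y| = 1$ and $Y \subseteq \langle X \rangle$; 2. the protocol runs for at most $c \cdot \max\{f,1\}$ synchronous rounds; 3. the non-faulty processors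 send at most $c \cdot n \cdot \max\{f,1\}^2$ messages in total; 4. each message sent by a non-faulty processor consists of at most $c \cdot n \cdot (\log_2 n + \log_2 |V|)$ bits (where $\log_2 0 := 0$). In particular, for $f \ge 1$, convex consensus on $\mathcal{C}$ is solvable in $O(f)$ synchronous rounds using $O(nf^2)$ messages of size $O(n(\log n + \log|V|))$. -/

import Mathlib

universe u

/-- A convexity space on `V`: a collection of ("convex") subsets of `V` that contains `∅` and `V`
and is closed under binary intersection. It is only used for finite `V`. -/
structure ConvexitySpace (V : Type u) where
  IsConvex : Set V → Prop
  empty_convex : IsConvex ∅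
  univ_convex : IsConvex Set.univ
  inter_convex : ∀ A B : Set V, IsConvex A → IsConvex B → IsConvex (A ∩ B)

namespace ConvexitySpace

variable {V : Type u} (C : ConvexitySpace V)

/-- The convex hull of `A`: the intersection of all convex sets that contain `A`. For finite `V`
it is the least convex set containing `A`, see `isLeast_hull`. -/
def hull (A : Set V) : Set V := ⋂₀ {K | C.IsConvex K ∧ A ⊆ K}

theorem sInter_convex [Finite V] (S : Set (Set V)) (hS : ∀ K ∈ S, C.IsConvex K) :
    C.IsConvex (⋂₀ S) := by
  induction S, Set.toFinite S using Set.Finite.induction_on with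
  | empty => simpa using C.univ_convex
  | insert _ _ ih =>
    rw [Set.sInter_insert]
    exact C.inter_convex _ _ (hS _ (Set.mem_insert _ _))
      (ih fun K hK => hS K (Set.mem_insert_of_mem _ hK))

theorem isLeast_hull [Finite V] (A : Set V) :
    IsLeast {K | C.IsConvex K ∧ A ⊆ K} (C.hull A) :=
  ⟨⟨C.sInter_convex _ fun _ hK => hK.1, Set.subset_sInter fun _ hK => hK.2⟩,
    fun _ hK => Set.sInter_subset_of_mem hK⟩

/-- A family of subsets of `V` is `k`-intersecting if each of its subfamilies with at most `k`
members has a nonempty intersection. -/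
def IsKIntersecting (k : ℕ) (𝒜 : Set (Set V)) : Prop :=
  ∀ ℬ : Finset (Set V), (ℬ : Set (Set V)) ⊆ 𝒜 → ℬ.card ≤ k → (⋂₀ (ℬ : Set (Set V))).Nonempty

/-- `ω` is the Helly number of `C`: the least `k` such that every finite `k`-intersecting family
of convex sets has a nonempty intersection. -/
def IsHellyNumber (ω : ℕ) : Prop :=
  IsLeast {k : ℕ | ∀ 𝒜 : Set (Set V), 𝒜.Finite → (∀ K ∈ 𝒜, C.IsConvex K) →
    IsKIntersecting k 𝒜 → (⋂₀ 𝒜).Nonempty} ω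

end ConvexitySpace

/-- A message is a bit string. -/
abbrev Message : Type := List Bool

/-- A deterministic synchronous message-passing protocol for `n` processors with inputs and
outputs in `V`, on the complete point-to-point network. It runs for `rounds` lock-step rounds,
numbered `0, …, rounds - 1`; then every processor (irrevocably) outputs a value.
`send i s j` is the message that processor `i` in state `s` sends to processor `j`
(`none`: no message); `update i s M` is the new state of `i`, where `M j` is the message that
`i` received from processor `j` (`none`: no message). -/
structure SyncProtocol (n : ℕ) (V : Type u) where
  State : Type u
  rounds : ℕ
  start : Fin n → V → State
  send : Fin n → State → Fin n → Option Message
  update : Fin n → State → (Fin n → Option Message) → State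
  output : Fin n → State → V

namespace SyncProtocol

variable {n : ℕ} {V : Type u} (A : SyncProtocol n V)

/-- An execution is determined by the inputs `x`, the set `F` of faulty processors and the
arbitrary behaviour `byz` of the faulty processors: `byz t j i` is the message (or `none`) that a
faulty processor `j` sends to processor `i` in round `t`, possibly a different one to each
receiver. `A.state F byz x t i` is the state of processor `i` at the start of round `t`; it is
meaningful for `i ∉ F` only (the value at `i ∈ F` influences nothing). -/
def state (F : Finset (Fin n)) (byz : ℕ → Fin n → Fin n → Option Message) (x : Fin n → V) :
    ℕ → Fin n → A.State
  | 0 => fun i => A.start i (x i)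
  | t + 1 => fun i =>
      A.update i (state F byz x t i)
        (fun j => if j ∈ F then byz t j i else A.send j (state F byz x t j) i)

/-- The message that the non-faulty processor `i` sends to processor `j` in round `t`. -/
def sent (F : Finset (Fin n)) (byz : ℕ → Fin n → Fin n → Option Message) (x : Fin n → V)
    (t : ℕ) (i j : Fin n) : Option Message :=
  A.send i (A.state F byz x t i) j

/-- The total number of messages sent by non-faulty processors during the execution. -/
def messageCount (F : Finset (Fin n)) (byz : ℕ → Fin n → Fin n → Option Message)
    (x : Fin n → V) : ℕ :=
  ∑ t ∈ Finset.range A.rounds,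
    (Finset.univ.filter fun p : Fin n × Fin n =>
      p.1 ∉ F ∧ (A.sent F byz x t p.1 p.2).isSome = true).card

/-- The set `Y` of the output values of the non-faulty processors. -/
def outputs (F : Finset (Fin n)) (byz : ℕ → Fin n → Fin n → Option Message)
    (x : Fin n → V) : Set V :=
  {y | ∃ i, i ∉ F ∧ A.output i (A.state F byz x A.rounds i) = y}

/-- `A` solves convex consensus on `C` in the presence of at most `f` Byzantine processors: in
every execution, the set `Y` of the outputs of the non-faulty processors satisfies `|Y| = 1`
(agreement) and lies in the convex hull of the set of their inputs (validity). -/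
def SolvesConvexConsensus (C : ConvexitySpace V) (f : ℕ) : Prop :=
  ∀ (F : Finset (Fin n)) (byz : ℕ → Fin n → Fin n → Option Message) (x : Fin n → V),
    F.card ≤ f →
      (A.outputs F byz x).ncard = 1 ∧
      A.outputs F byz x ⊆ C.hull {v | ∃ i, i ∉ F ∧ x i = v}

/-- In every execution with at most `f` Byzantine processors, the non-faulty processors send at
most `m` messages in total. -/
def MessagesAtMost (f m : ℕ) : Prop :=
  ∀ (F : Finset (Fin n)) (byz : ℕ → Fin n → Fin n → Option Message) (x : Fin n → V),
    F.card ≤ f → A.messageCount F byz x ≤ m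

/-- In every execution with at most `f` Byzantine processors, each message sent by a non-faulty
processor consists of at most `b` bits. -/
def MessageSizeAtMost (f : ℕ) (b : ℝ) : Prop :=
  ∀ (F : Finset (Fin n)) (byz : ℕ → Fin n → Fin n → Option Message) (x : Fin n → V),
    F.card ≤ f → ∀ t < A.rounds, ∀ i j : Fin n, i ∉ F →
      ∀ m : Message, A.sent F byz x t i j = some m → (m.length : ℝ) ≤ b

end SyncProtocol

/-!
The protocol lets a committee of `3f + 1` processors agree on the whole vector of inputs, and then
applies the Helly property to that vector.

In the first round every processor reports its input to the committee. Then `f + 1` phases of the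
"phase king" algorithm run, simultaneously for each of the `n` reported values; in each of them the
committee members send the vector of their `n` current values to everybody, and all processors,
members or not, update their own vector in the same way. A phase has three rounds: voting with
quorum `2f + 1`, after which any two non-faulty processors that saw a quorum saw it for the same
value; a second vote, in which `f + 1` votes select a value and `2f + 1` votes lock it; and the
message of the king of the phase, whose value replaces the unlocked ones. A common value of the
non-faulty committee members survives every phase (`phase_persistence`), and a phase with a
non-faulty king creates one (`phase_agreement`). One of the `f + 1` kings is non-faulty, so in the
end all non-faulty processors hold the same vector `w`, and `w k` is the input of `k` whenever `k`
is non-faulty (`exists_common_vector`).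

Finally, every processor computes the same point in the intersection of the hulls of all
subfamilies of `w` that omit at most `f` entries. Any `ω` of these subfamilies have an entry in
common because `ω f < n`, so the intersection is nonempty by the Helly property
(`exists_mem_hull_of_card_le`); and it lies in the hull of the non-faulty inputs.

Per round there are at most `n (3f + 1)` messages, each encoding a vector with entries in
`Option V`. If `n = 1` the size bound may leave no room for such a vector, but then no
communication is needed.
-/

open Finset

universe v

/-! ### The decision rule -/

/-- The common point of the hulls of all subfamilies of `w` that omit at most `f` indices. -/
theorem ConvexitySpace.exists_mem_hull_of_card_le {V : Type u} [Finite V] (C : ConvexitySpace V)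
    {ω n f : ℕ} (hω : C.IsHellyNumber ω) (hn : ω * f < n) (w : Fin n → V) :
    ∃ y, ∀ S : Finset (Fin n), S.card ≤ f → y ∈ C.hull {v | ∃ i, i ∉ S ∧ w i = v} := by
  classical
  let H : Finset (Fin n) → Set V := fun S => C.hull {v | ∃ i, i ∉ S ∧ w i = v}
  obtain ⟨y, hy⟩ := hω.1 (H '' {S | S.card ≤ f}) (Set.toFinite _)
    (by
      rintro _ ⟨S, -, rfl⟩
      exact (C.isLeast_hull _).1.1)
    (by
      intro B hB hcard
      choose! S hS hSK using fun K (hK : K ∈ B) => hB hK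
      have hlt : (B.biUnion S).card < (univ : Finset (Fin n)).card := by
        calc (B.biUnion S).card ≤ B.card * f := card_biUnion_le_card_mul _ _ _ hS
          _ ≤ ω * f := Nat.mul_le_mul_right _ hcard
          _ < _ := by simpa using hn
      obtain ⟨i, -, hi⟩ := exists_mem_notMem_of_card_lt_card hlt
      refine ⟨w i, fun K hK => ?_⟩
      rw [← hSK K hK]
      exact (C.isLeast_hull _).1.2 ⟨i, fun h => hi (mem_biUnion.2 ⟨K, hK, h⟩), rfl⟩)
  exact ⟨y, fun S hS => hy _ ⟨S, hS, rfl⟩⟩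

/-! ### One phase of the phase king algorithm -/

section Phase

variable {ι : Type*} {α : Type v}

/-- The members of the committee `S` whose received vote `r j` is `v`; a vote `none` is an
abstention (or a missing message). -/
noncomputable def votes (S : Finset ι) (r : ι → Option α) (v : α) : Finset ι :=
  open Classical in S.filter fun j => r j = some v

/-- Some value with at least `θ` votes, and `none` if there is no such value. -/
noncomputable def quorumValue (S : Finset ι) (θ : ℕ) (r : ι → Option α) : Option α :=
  open Classical in if h : ∃ v, θ ≤ (votes S r v).card then some h.choose else none

theorem le_card_votes_of_quorumValue_eq {S : Finset ι} {θ : ℕ} {r : ι → Option α} {v : α}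
    (h : quorumValue S θ r = some v) : θ ≤ (votes S r v).card := by
  unfold quorumValue at h
  split_ifs at h with hex
  rw [← Option.some.inj h]
  exact hex.choose_spec

theorem exists_quorumValue_eq {S : Finset ι} {θ : ℕ} {r : ι → Option α} {v : α}
    (h : θ ≤ (votes S r v).card) : ∃ w, quorumValue S θ r = some w := by
  have hex : ∃ v, θ ≤ (votes S r v).card := ⟨v, h⟩
  exact ⟨hex.choose, by simp [quorumValue, hex]⟩

theorem mem_votes {S : Finset ι} {r : ι → Option α} {v : α} {j : ι} :
    j ∈ votes S r v ↔ j ∈ S ∧ r j = some v := by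
  simp [votes]

variable {S F : Finset ι} {f : ℕ}

/-- More than `f` votes for `v` include a vote of a non-faulty member. -/
theorem exists_mem_votes_notMem (hF : F.card ≤ f) {r : ι → Option α} {v : α}
    (h : f + 1 ≤ (votes S r v).card) : ∃ j ∈ S, j ∉ F ∧ r j = some v := by
  obtain ⟨j, hj, hjF⟩ := exists_mem_notMem_of_card_lt_card (lt_of_le_of_lt hF h)
  exact ⟨j, (mem_votes.1 hj).1, hjF, (mem_votes.1 hj).2⟩

variable [DecidableEq ι]

theorem le_card_sdiff_of_card_eq (hS : S.card = 3 * f + 1) (hF : F.card ≤ f) :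
    2 * f + 1 ≤ (S \ F).card := by
  have := le_card_sdiff F S
  omega

theorem le_card_votes_of_forall (hS : S.card = 3 * f + 1) (hF : F.card ≤ f)
    {r : ι → Option α} {v : α} (h : ∀ j ∈ S, j ∉ F → r j = some v) :
    2 * f + 1 ≤ (votes S r v).card :=
  (le_card_sdiff_of_card_eq hS hF).trans <| card_le_card fun j hj =>
    mem_votes.2 ⟨(mem_sdiff.1 hj).1, h j (mem_sdiff.1 hj).1 (mem_sdiff.1 hj).2⟩

/-- If `2f + 1` of the received votes are for `v`, then so are `f + 1` of the votes that anybody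
else receives, provided that non-faulty members send the same vote to everybody. -/
theorem le_card_votes_of_le_card_votes (hF : F.card ≤ f) {a r r' : ι → Option α} {v : α}
    (hr : ∀ j ∈ S, j ∉ F → r j = a j) (hr' : ∀ j ∈ S, j ∉ F → r' j = a j)
    (h : 2 * f + 1 ≤ (votes S r v).card) : f + 1 ≤ (votes S r' v).card := by
  have h1 := le_card_sdiff F (votes S r v)
  have h2 : votes S r v \ F ⊆ votes S r' v := by
    intro j hj
    obtain ⟨hj, hjF⟩ := mem_sdiff.1 hj
    obtain ⟨hjS, hjv⟩ := mem_votes.1 hj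
    exact mem_votes.2 ⟨hjS, by rw [hr' j hjS hjF, ← hr j hjS hjF, hjv]⟩
  have h3 := card_le_card h2
  omega

/-- Two quorums of `2f + 1` votes out of `3f + 1` share a non-faulty member, hence are for the
same value. -/
theorem eq_of_le_card_votes (hS : S.card = 3 * f + 1) (hF : F.card ≤ f)
    {a r r' : ι → Option α} {v v' : α}
    (hr : ∀ j ∈ S, j ∉ F → r j = a j) (hr' : ∀ j ∈ S, j ∉ F → r' j = a j)
    (h : 2 * f + 1 ≤ (votes S r v).card) (h' : 2 * f + 1 ≤ (votes S r' v').card) : v = v' := by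
  have hunion : (votes S r v ∪ votes S r' v').card ≤ S.card :=
    card_le_card fun j hj => (mem_union.1 hj).elim (fun h => (mem_votes.1 h).1)
      fun h => (mem_votes.1 h).1
  have hadd := card_union_add_card_inter (votes S r v) (votes S r' v')
  obtain ⟨j, hj, hjF⟩ := exists_mem_notMem_of_card_lt_card
    (show F.card < (votes S r v ∩ votes S r' v').card by omega)
  obtain ⟨hj1, hj2⟩ := mem_inter.1 hj
  obtain ⟨hjS, hjv⟩ := mem_votes.1 hj1
  have hjv' := (mem_votes.1 hj2).2
  rw [hr j hjS hjF] at hjv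
  rw [hr' j hjS hjF, hjv] at hjv'
  exact Option.some.inj hjv'

/-- A value is locked if it has `2f + 1` votes. -/
def IsLocked (S : Finset ι) (f : ℕ) (r : ι → Option α) : Prop :=
  ∃ v, 2 * f + 1 ≤ (votes S r v).card

/-- The value of a processor at the end of a phase: `e` is its selected value, `l` says whether
it is locked, `m` is the value received from the king, and `v₀` replaces a missing one,
so that no processor enters the next phase with an abstention, which would not be persistent. -/
noncomputable def kingUpdate (v₀ : α) (e : Option α) (l : Prop) (m : Option α) : Option α :=
  open Classical in if l then e else some (m.getD v₀)

/-- In a phase with committee `S` and faulty set `F`, the non-faulty processors start with the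
values `a`, receive the first votes `r₀ i` and the second votes `r₁ i`, and end with the
values `a'`; `m i` is what `i` receives from the king. -/
structure IsPhase (S F : Finset ι) (f : ℕ) (v₀ : α) (a : ι → Option α)
    (r₀ r₁ : ι → ι → Option α) (m : ι → Option α) (a' : ι → Option α) : Prop where
  first : ∀ i ∉ F, ∀ j ∈ S, j ∉ F → r₀ i j = a j
  second : ∀ i ∉ F, ∀ j ∈ S, j ∉ F → r₁ i j = quorumValue S (2 * f + 1) (r₀ j)
  result : ∀ i ∉ F,
    a' i = kingUpdate v₀ (quorumValue S (f + 1) (r₁ i)) (IsLocked S f (r₁ i)) (m i)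

variable {v₀ : α} {a a' m : ι → Option α} {r₀ r₁ : ι → ι → Option α}

/-- In the second vote, all values with more than `f` votes coincide. -/
theorem IsPhase.eq_of_le_card_votes (h : IsPhase S F f v₀ a r₀ r₁ m a')
    (hS : S.card = 3 * f + 1) (hF : F.card ≤ f) {i i' : ι} (hi : i ∉ F) (hi' : i' ∉ F)
    {v v' : α} (hv : f + 1 ≤ (votes S (r₁ i) v).card)
    (hv' : f + 1 ≤ (votes S (r₁ i') v').card) : v = v' := by
  obtain ⟨j, hjS, hjF, hj⟩ := exists_mem_votes_notMem hF hv
  obtain ⟨j', hjS', hjF', hj'⟩ := exists_mem_votes_notMem hF hv'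
  rw [h.second i hi j hjS hjF] at hj
  rw [h.second i' hi' j' hjS' hjF'] at hj'
  exact _root_.eq_of_le_card_votes hS hF (h.first j hjF) (h.first j' hjF')
    (le_card_votes_of_quorumValue_eq hj) (le_card_votes_of_quorumValue_eq hj')

/-- If a value is locked by one non-faulty processor, it is selected by all of them. -/
theorem IsPhase.quorumValue_eq (h : IsPhase S F f v₀ a r₀ r₁ m a')
    (hS : S.card = 3 * f + 1) (hF : F.card ≤ f) {i i' : ι} (hi : i ∉ F) (hi' : i' ∉ F)
    {v : α} (hv : 2 * f + 1 ≤ (votes S (r₁ i) v).card) :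
    quorumValue S (f + 1) (r₁ i') = some v := by
  have hv' := le_card_votes_of_le_card_votes hF (h.second i hi) (h.second i' hi') hv
  obtain ⟨w, hw⟩ := exists_quorumValue_eq hv'
  rw [hw, h.eq_of_le_card_votes hS hF hi' hi' (le_card_votes_of_quorumValue_eq hw) hv']

/-- A common value of the non-faulty committee members becomes a common value of all non-faulty
processors, whoever is king. -/
theorem phase_persistence (h : IsPhase S F f v₀ a r₀ r₁ m a')
    (hS : S.card = 3 * f + 1) (hF : F.card ≤ f) {v : α}
    (ha : ∀ j ∈ S, j ∉ F → a j = some v) {i : ι} (hi : i ∉ F) : a' i = some v := by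
  have hfirst : ∀ j ∉ F, 2 * f + 1 ≤ (votes S (r₀ j) v).card := fun j hj =>
    le_card_votes_of_forall hS hF fun k hk hkF => by rw [h.first j hj k hk hkF, ha k hk hkF]
  have hsecond : 2 * f + 1 ≤ (votes S (r₁ i) v).card := by
    refine le_card_votes_of_forall hS hF fun j hj hjF => ?_
    obtain ⟨w, hw⟩ := exists_quorumValue_eq (hfirst j hjF)
    rw [h.second i hi j hj hjF, hw, _root_.eq_of_le_card_votes hS hF (h.first j hjF)
      (h.first j hjF) (le_card_votes_of_quorumValue_eq hw) (hfirst j hjF)]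
  rw [h.result i hi, kingUpdate, if_pos ⟨v, hsecond⟩]
  exact h.quorumValue_eq hS hF hi hi hsecond

/-- A phase with a non-faulty king `q` ends with a common value of all non-faulty processors. -/
theorem phase_agreement (h : IsPhase S F f v₀ a r₀ r₁ m a')
    (hS : S.card = 3 * f + 1) (hF : F.card ≤ f) {q : ι} (hq : q ∉ F)
    (hm : ∀ i ∉ F, m i = quorumValue S (f + 1) (r₁ q)) :
    ∃ v, ∀ i ∉ F, a' i = some v := by
  refine ⟨(quorumValue S (f + 1) (r₁ q)).getD v₀, fun i hi => ?_⟩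
  rw [h.result i hi, kingUpdate]
  split_ifs with hl
  · obtain ⟨v, hv⟩ := hl
    rw [h.quorumValue_eq hS hF hi hi hv, h.quorumValue_eq hS hF hi hq hv, Option.getD_some]
  · rw [hm i hi]

end Phase

/-! ### Bit strings -/

theorem exists_injective_message (α : Type v) [Fintype α] :
    ∃ enc : α → Message, Function.Injective enc ∧
      ∀ a, 2 ^ (enc a).length ≤ 2 * Fintype.card α := by
  refine ⟨fun a => Nat.bits (Fintype.equivFin α a), fun a b h => ?_, fun a => ?_⟩
  · have hbits : ∀ {m k : ℕ}, m.bits = k.bits → m = k := fun {m k} hmk =>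
      Nat.eq_of_testBit_eq fun i => by
        rw [Nat.testBit_eq_inth, Nat.testBit_eq_inth, hmk]
    exact (Fintype.equivFin α).injective (Fin.ext (hbits h))
  · have hlt := (Fintype.equivFin α a).isLt
    set k : ℕ := (Fintype.equivFin α a : ℕ)
    show 2 ^ k.bits.length ≤ _
    rw [Nat.size_eq_bits_len]
    rcases Nat.eq_zero_or_pos k.size with h0 | h0
    · rw [h0]; omega
    · have h1 : 2 ^ (k.size - 1) ≤ k := Nat.lt_size.1 (by omega)
      have h2 : 2 ^ k.size = 2 * 2 ^ (k.size - 1) := by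
        rw [← pow_succ', Nat.sub_add_cancel h0]
      omega

/-! ### The protocol -/

/-- The state of a processor: the number of elapsed rounds, the current value in each of the `n`
agreement instances, and whether that value is locked. -/
structure KingState (n : ℕ) (V : Type u) where
  clock : ℕ
  val : Fin n → Option V
  locked : Fin n → Prop

/-- The first `3f + 1` processors. -/
def committee (n f : ℕ) : Finset (Fin n) := univ.filter fun j => (j : ℕ) < 3 * f + 1

theorem mem_committee {n f : ℕ} {j : Fin n} : j ∈ committee n f ↔ (j : ℕ) < 3 * f + 1 := by
  simp [committee]

theorem card_committee {n f : ℕ} (h : 3 * f < n) : (committee n f).card = 3 * f + 1 := by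
  rw [committee, Fin.card_filter_val_lt]
  omega

section Protocol

variable {n : ℕ} {V : Type u} [NeZero n]

/-- The update of the state, given the decoded messages `r`. Round `0` collects the inputs; the
rounds `3p + 1`, `3p + 2`, `3p + 3` form phase `p`, whose king is processor `p`.
Only the committee is sent the inputs, so a processor outside it enters phase `0` with meaningless
values; this is harmless, because the votes of a phase are those of the committee. -/
noncomputable def kingStep (f : ℕ) (v₀ : V) (s : KingState n V) (r : Fin n → Fin n → Option V) :
    KingState n V where
  clock := s.clock + 1
  val k :=
    if s.clock = 0 then some ((r k k).getD v₀)
    else if s.clock % 3 = 1 then quorumValue (committee n f) (2 * f + 1) fun j => r j k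
    else if s.clock % 3 = 2 then quorumValue (committee n f) (f + 1) fun j => r j k
    else kingUpdate v₀ (s.val k) (s.locked k) (r (Fin.ofNat n (s.clock / 3 - 1)) k)
  locked k := IsLocked (committee n f) f fun j => r j k

/-- The vector encoded by a message; a missing message counts as a vector of abstentions. -/
def decodeVector (dec : Message → Fin n → Option V) (m : Option Message) : Fin n → Option V :=
  m.elim (fun _ => none) dec

/-- The phase king protocol in `n` parallel instances, the `k`-th one on the input of
processor `k`, followed by the decision `decide` on the resulting vector. -/
noncomputable def kingProtocol (f : ℕ) (v₀ : V) (enc : (Fin n → Option V) → Message)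
    (dec : Message → Fin n → Option V) (decide : (Fin n → V) → V) : SyncProtocol n V where
  State := KingState n V
  rounds := 3 * (f + 1) + 1
  start _ v := ⟨0, fun _ => some v, fun _ => False⟩
  send i s j :=
    if (if s.clock = 0 then j else i) ∈ committee n f then some (enc s.val) else none
  update _ s M := kingStep f v₀ s fun j => decodeVector dec (M j)
  output _ s := decide fun k => (s.val k).getD v₀

variable {f : ℕ} {v₀ : V} {enc : (Fin n → Option V) → Message}
  {dec : Message → Fin n → Option V} {decide : (Fin n → V) → V}

local notation "𝒫" => kingProtocol f v₀ enc dec decide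

variable (F : Finset (Fin n)) (byz : ℕ → Fin n → Fin n → Option Message) (x : Fin n → V)

variable (f v₀ enc dec decide) in
/-- The vector that processor `i` receives from processor `j` in round `t`. -/
noncomputable def received (t : ℕ) (i j : Fin n) : Fin n → Option V :=
  decodeVector dec
    (if j ∈ F then byz t j i else (𝒫).send j ((𝒫).state F byz x t j) i)

variable (f v₀ enc dec decide) in
/-- The state of processor `i` at the start of round `t`. -/
noncomputable def stateAt (t : ℕ) (i : Fin n) : KingState n V :=
  (𝒫).state F byz x t i

variable (f v₀ enc dec decide) in
/-- The value vector of processor `i` at the start of round `t`. -/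
noncomputable def valueAt (t : ℕ) (i : Fin n) : Fin n → Option V :=
  (stateAt f v₀ enc dec decide F byz x t i).val

local notation "ρ" => received f v₀ enc dec decide F byz x
local notation "ν" => valueAt f v₀ enc dec decide F byz x

local notation "σ" => stateAt f v₀ enc dec decide F byz x

theorem stateAt_succ (t : ℕ) (i : Fin n) :
    σ (t + 1) i = kingStep f v₀ (σ t i) (ρ t i) :=
  rfl

theorem clock_stateAt (t : ℕ) (i : Fin n) : (σ t i).clock = t := by
  induction t with
  | zero => rfl
  | succ t ih => rw [stateAt_succ, kingStep, ih]

theorem sent_kingProtocol (t : ℕ) (i j : Fin n) :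
    (𝒫).sent F byz x t i j =
      if (if t = 0 then j else i) ∈ committee n f then some (enc (ν t i)) else none := by
  have h : (𝒫).sent F byz x t i j =
      if (if (σ t i).clock = 0 then j else i) ∈ committee n f then some (enc (ν t i)) else none :=
    rfl
  rw [h, clock_stateAt]

theorem received_eq (hdec : Function.LeftInverse dec enc) {t : ℕ} {i j : Fin n} (hj : j ∉ F)
    (h : (if t = 0 then i else j) ∈ committee n f) : ρ t i j = ν t j := by
  have hsent := sent_kingProtocol (f := f) (v₀ := v₀) (enc := enc) (dec := dec) (decide := decide)
    F byz x t j i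
  rw [if_pos h, SyncProtocol.sent] at hsent
  rw [received, if_neg hj, hsent, decodeVector, Option.elim_some, hdec]

theorem valueAt_one (i k : Fin n) : ν 1 i k = some ((ρ 0 i k k).getD v₀) := rfl

theorem valueAt_first (p : ℕ) (i k : Fin n) :
    ν (3 * p + 2) i k =
      quorumValue (committee n f) (2 * f + 1) fun j => ρ (3 * p + 1) i j k := by
  rw [valueAt, stateAt_succ, kingStep]
  simp only [clock_stateAt]
  rw [if_neg (by omega), if_pos (by omega)]

theorem valueAt_second (p : ℕ) (i k : Fin n) :
    ν (3 * p + 3) i k = quorumValue (committee n f) (f + 1) fun j => ρ (3 * p + 2) i j k := by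
  rw [valueAt, stateAt_succ, kingStep]
  simp only [clock_stateAt]
  rw [if_neg (by omega), if_neg (by omega), if_pos (by omega)]

theorem valueAt_third (p : ℕ) (i k : Fin n) :
    ν (3 * (p + 1) + 1) i k =
      kingUpdate v₀ (quorumValue (committee n f) (f + 1) fun j => ρ (3 * p + 2) i j k)
        (IsLocked (committee n f) f fun j => ρ (3 * p + 2) i j k)
        (ρ (3 * p + 3) i (Fin.ofNat n p) k) := by
  rw [← valueAt_second]
  rw [show 3 * (p + 1) + 1 = 3 * p + 3 + 1 by ring, valueAt, stateAt_succ, kingStep]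
  simp only [clock_stateAt]
  rw [if_neg (by omega), if_neg (by omega), if_neg (by omega),
    show (3 * p + 3) / 3 - 1 = p by omega]
  rfl

/-- Every instance `k` goes through the phases of the phase king algorithm. -/
theorem isPhase_valueAt (hdec : Function.LeftInverse dec enc) (p : ℕ) (k : Fin n) :
    IsPhase (committee n f) F f v₀ (fun i => ν (3 * p + 1) i k)
      (fun i j => ρ (3 * p + 1) i j k) (fun i j => ρ (3 * p + 2) i j k)
      (fun i => ρ (3 * p + 3) i (Fin.ofNat n p) k) (fun i => ν (3 * (p + 1) + 1) i k) where
  first i _ j hj hjF := by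
    rw [received_eq F byz x hdec hjF (by simpa using hj)]
  second i _ j hj hjF := by
    rw [received_eq F byz x hdec hjF (by simpa using hj), valueAt_first]
  result i _ := valueAt_third F byz x p i k

/-- A common value of the non-faulty committee members at the start of a phase is the final value
of all non-faulty processors. -/
theorem valueAt_end_of_common (hdec : Function.LeftInverse dec enc) (hn : 3 * f < n)
    (hF : F.card ≤ f) {k : Fin n} {v : V} {p P : ℕ} (hp : p < P)
    (h : ∀ j ∈ committee n f, j ∉ F → ν (3 * p + 1) j k = some v) {i : Fin n} (hi : i ∉ F) :
    ν (3 * P + 1) i k = some v := by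
  induction P, hp using Nat.le_induction generalizing i with
  | base =>
    exact phase_persistence (isPhase_valueAt F byz x hdec p k) (card_committee hn) hF h hi
  | succ P _ ih =>
    exact phase_persistence (isPhase_valueAt F byz x hdec P k) (card_committee hn) hF
      (fun j _ hj => ih hj) hi

/-- The phase with a non-faulty king creates a common value, which then survives to the end. -/
theorem exists_valueAt_end_eq (hdec : Function.LeftInverse dec enc) (hn : 3 * f < n)
    (hF : F.card ≤ f) (k : Fin n) :
    ∃ v, ∀ i ∉ F, ν (3 * (f + 1) + 1) i k = some v := by
  obtain ⟨q, hq, hqF⟩ : ∃ q ∈ univ.filter (fun q : Fin n => (q : ℕ) < f + 1), q ∉ F := by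
    refine exists_mem_notMem_of_card_lt_card ?_
    rw [Fin.card_filter_val_lt]
    omega
  have hqf : (q : ℕ) < f + 1 := (mem_filter.1 hq).2
  have hking : Fin.ofNat n (q : ℕ) = q := by simp
  obtain ⟨v, hv⟩ := phase_agreement
    (isPhase_valueAt (v₀ := v₀) (decide := decide) F byz x hdec (q : ℕ) k)
    (card_committee hn) hF hqF (by
      intro i _
      rw [hking, received_eq F byz x hdec hqF
        (by rw [if_neg (by omega), mem_committee]; omega), valueAt_second])
  refine ⟨v, fun i hi => ?_⟩
  rcases (Nat.succ_le_of_lt hqf).eq_or_lt with h | h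
  · have := hv i hi
    rwa [show (q : ℕ) + 1 = f + 1 from h] at this
  · exact valueAt_end_of_common F byz x hdec hn hF h (fun j _ hj => hv j hj) hi

/-- At the end all non-faulty processors hold the same vector, which contains the inputs of the
non-faulty processors. -/
theorem exists_common_vector (hdec : Function.LeftInverse dec enc) (hn : 3 * f < n)
    (hF : F.card ≤ f) :
    ∃ w : Fin n → V, (∀ i ∉ F, ∀ k, ν (3 * (f + 1) + 1) i k = some (w k)) ∧
      ∀ k ∉ F, w k = x k := by
  have hcommon : ∀ k, ∃ v, ∀ i ∉ F, ν (3 * (f + 1) + 1) i k = some v :=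
    exists_valueAt_end_eq F byz x hdec hn hF
  choose w hw using hcommon
  refine ⟨w, fun i hi k => hw k i hi, fun k hk => ?_⟩
  have hend : ν (3 * (f + 1) + 1) k k = some (x k) := by
    refine valueAt_end_of_common F byz x hdec hn hF (p := 0) (Nat.succ_pos f) ?_ hk
    intro j hj _
    rw [valueAt_one, received_eq F byz x hdec hk (by simpa using hj)]
    rfl
  exact Option.some.inj ((hw k k hk).symm.trans hend)

theorem kingProtocol_solvesConvexConsensus (C : ConvexitySpace V)
    (hdec : Function.LeftInverse dec enc) (hn : 3 * f < n)
    (hdecide : ∀ (w : Fin n → V) (S : Finset (Fin n)), S.card ≤ f →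
      decide w ∈ C.hull {v | ∃ i, i ∉ S ∧ w i = v}) :
    (𝒫).SolvesConvexConsensus C f := by
  intro F byz x hF
  obtain ⟨w, hw, hwx⟩ :=
    exists_common_vector (v₀ := v₀) (decide := decide) F byz x hdec hn hF
  have hout : ∀ i ∉ F, (𝒫).output i ((𝒫).state F byz x (𝒫).rounds i) = decide w := by
    intro i hi
    have : (fun k => (valueAt f v₀ enc dec decide F byz x (3 * (f + 1) + 1) i k).getD v₀) = w := by
      funext k
      rw [hw i hi k, Option.getD_some]
    exact congrArg decide this
  obtain ⟨i₀, -, hi₀⟩ := exists_mem_notMem_of_card_lt_card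
    (show F.card < (univ : Finset (Fin n)).card by rw [card_univ, Fintype.card_fin]; omega)
  have hset : (𝒫).outputs F byz x = {decide w} := by
    ext y
    constructor
    · rintro ⟨i, hi, rfl⟩
      exact hout i hi
    · rintro rfl
      exact ⟨i₀, hi₀, hout i₀ hi₀⟩
  have hinputs : {v | ∃ i, i ∉ F ∧ w i = v} = {v | ∃ i, i ∉ F ∧ x i = v} := by
    ext v
    exact exists_congr fun i => and_congr_right fun hi => by rw [hwx i hi]
  rw [hset]
  refine ⟨Set.ncard_singleton _, Set.singleton_subset_iff.2 ?_⟩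
  rw [← hinputs]
  exact hdecide w F hF

theorem kingProtocol_messagesAtMost (hn : 3 * f < n) :
    (𝒫).MessagesAtMost f ((3 * (f + 1) + 1) * (n * (3 * f + 1))) := by
  intro F byz x _
  refine (sum_le_card_nsmul (range (𝒫).rounds) _ (n * (3 * f + 1)) fun t _ => ?_).trans_eq
    (by rw [card_range, smul_eq_mul]; rfl)
  have hsent : ∀ i j, ((𝒫).sent F byz x t i j).isSome = true →
      (if t = 0 then j else i) ∈ committee n f := by
    intro i j h
    rw [sent_kingProtocol] at h
    by_contra hne
    rw [if_neg hne] at h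
    simp at h
  by_cases ht : t = 0
  · calc _ ≤ ((univ : Finset (Fin n)) ×ˢ committee n f).card := by
          refine card_le_card fun p hp => ?_
          have := hsent p.1 p.2 (mem_filter.1 hp).2.2
          rw [if_pos ht] at this
          exact mem_product.2 ⟨mem_univ _, this⟩
      _ = _ := by rw [card_product, card_committee hn, card_univ, Fintype.card_fin]
  · calc _ ≤ (committee n f ×ˢ (univ : Finset (Fin n))).card := by
          refine card_le_card fun p hp => ?_
          have := hsent p.1 p.2 (mem_filter.1 hp).2.2
          rw [if_neg ht] at this
          exact mem_product.2 ⟨this, mem_univ _⟩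
      _ = _ := by rw [card_product, card_committee hn, card_univ, Fintype.card_fin, mul_comm]

theorem kingProtocol_messageSizeAtMost {b : ℝ} (henc : ∀ a, ((enc a).length : ℝ) ≤ b) :
    (𝒫).MessageSizeAtMost f b := by
  intro F byz x _ t _ i j _ m hm
  rw [sent_kingProtocol] at hm
  split_ifs at hm
  all_goals
    rw [← Option.some.inj hm]
    exact henc _

end Protocol

/-- The silent protocol, in which every processor outputs its input. -/
def silentProtocol (n : ℕ) (V : Type u) : SyncProtocol n V where
  State := V
  rounds := 0
  start _ v := v
  send _ _ _ := none
  update _ s _ := s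
  output _ s := s

/-! ### The resource bounds -/

/-- A vector of `n ≥ 2` entries in `Option V` fits into `O(n (log n + log |V|))` bits. -/
theorem length_le_of_two_pow_le {n N ℓ : ℕ} (hn : 2 ≤ n) (hN : 0 < N)
    (h : 2 ^ ℓ ≤ 2 * (N + 1) ^ n) :
    (ℓ : ℝ) ≤ 2 * (n * (Real.logb 2 n + Real.logb 2 N)) := by
  have hN' : (1 : ℝ) ≤ N := by exact_mod_cast hN
  have hn' : (2 : ℝ) ≤ n := by exact_mod_cast hn
  have h1 : (2 : ℝ) ^ ℓ ≤ 2 * (2 * N) ^ n := by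
    calc (2 : ℝ) ^ ℓ ≤ 2 * ((N : ℝ) + 1) ^ n := by exact_mod_cast h
      _ ≤ _ := by gcongr; linarith
  have h2 := Real.logb_le_logb_of_le (b := 2) (by norm_num) (by positivity) h1
  rw [Real.logb_mul (by norm_num) (by positivity), Real.logb_pow, Real.logb_pow,
    Real.logb_mul (by norm_num) (by positivity), Real.logb_self_eq_one (by norm_num)] at h2
  have h3 : 1 ≤ Real.logb 2 n := by
    rw [← Real.logb_self_eq_one (b := 2) (by norm_num)]
    exact Real.logb_le_logb_of_le (by norm_num) (by norm_num) hn'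
  have h4 : 0 ≤ Real.logb 2 N := Real.logb_nonneg (by norm_num) hN'
  nlinarith [mul_nonneg (by linarith : (0 : ℝ) ≤ n) (sub_nonneg.2 h3),
    mul_nonneg (by linarith : (0 : ℝ) ≤ n) h4]

theorem mainTheorem3 :
    ∃ c : ℕ, ∀ (V : Type u) [Fintype V] (C : ConvexitySpace V) (ω n f : ℕ),
      C.IsHellyNumber ω → max (3 * f) (ω * f) < n →
        ∃ A : SyncProtocol n V,
          A.SolvesConvexConsensus C f ∧
          A.rounds ≤ c * max f 1 ∧
          A.MessagesAtMost f (c * (n * max f 1 ^ 2)) ∧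
          A.MessageSizeAtMost f
            (c * (n * (Real.logb 2 n + Real.logb 2 (Fintype.card V)))) := by
  -- `28 = 7 * 4` bounds the `3 f + 4` rounds times the factor `3 f + 1` per round.
  refine ⟨28, fun V _ C ω n f hω hlt => ?_⟩
  obtain ⟨hn3, hnω⟩ := max_lt_iff.1 hlt
  have hpos : 0 < n := by omega
  have : NeZero n := ⟨hpos.ne'⟩
  rcases isEmpty_or_nonempty V with hV | hV
  · -- There are no inputs, hence no executions.
    exact ⟨silentProtocol n V, fun _ _ x => (hV.false (x 0)).elim, Nat.zero_le _,
      fun _ _ x => (hV.false (x 0)).elim, fun _ _ x => (hV.false (x 0)).elim⟩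
  rcases Nat.lt_or_ge n 2 with hn1 | hn2
  · obtain rfl : n = 1 := by omega
    obtain rfl : f = 0 := by omega
    refine ⟨silentProtocol 1 V, fun F byz x hF => ?_, Nat.zero_le _, fun F byz x _ => Nat.zero_le _,
      fun F byz x _ t ht => (Nat.not_lt_zero t ht).elim⟩
    obtain rfl : F = ∅ := card_eq_zero.1 (Nat.le_zero.1 hF)
    have hout : (silentProtocol 1 V).outputs ∅ byz x = {x 0} := by
      ext y
      constructor
      · rintro ⟨i, -, rfl⟩
        rw [Subsingleton.elim i 0]
        rfl
      · rintro rfl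
        exact ⟨0, notMem_empty _, rfl⟩
    rw [hout]
    exact ⟨Set.ncard_singleton _,
      Set.singleton_subset_iff.2 ((C.isLeast_hull _).1.2 ⟨0, notMem_empty _, rfl⟩)⟩
  · classical
    obtain ⟨v₀⟩ := hV
    obtain ⟨enc, hinj, hlen⟩ := exists_injective_message (Fin n → Option V)
    choose decide hdecide using C.exists_mem_hull_of_card_le hω hnω
    have hf : f ≤ max f 1 := le_max_left _ _
    have h1 : 1 ≤ max f 1 := le_max_right _ _
    have hrounds : 3 * (f + 1) + 1 ≤ 7 * max f 1 := by omega
    have hfan : 3 * f + 1 ≤ 4 * max f 1 := by omega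
    refine ⟨kingProtocol f v₀ enc (Function.invFun enc) decide,
      kingProtocol_solvesConvexConsensus C (Function.leftInverse_invFun hinj) hn3 hdecide,
      hrounds.trans (Nat.mul_le_mul_right _ (by norm_num)), fun F byz x hF => ?_,
      kingProtocol_messageSizeAtMost fun a => ?_⟩
    · refine (kingProtocol_messagesAtMost hn3 F byz x hF).trans ?_
      calc (3 * (f + 1) + 1) * (n * (3 * f + 1)) ≤ 7 * max f 1 * (n * (4 * max f 1)) := by gcongr
        _ = 28 * (n * max f 1 ^ 2) := by ring
    · have hcard := hlen a
      rw [Fintype.card_fun, Fintype.card_option, Fintype.card_fin] at hcard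
      have hN : 0 < Fintype.card V := Fintype.card_pos_iff.2 ⟨v₀⟩
      have hb := length_le_of_two_pow_le hn2 hN hcard
      have hnonneg : 0 ≤ (n : ℝ) * (Real.logb 2 n + Real.logb 2 (Fintype.card V)) := by
        have hlen0 : (0 : ℝ) ≤ (enc a).length := Nat.cast_nonneg _
        linarith
      push_cast
      linarith
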